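/- Let $N\in\mathbb N$, let $G\in\mathbb R^{N\times N}$ be arbitrary and let $t_0>0$. Consider the NAGD game dynamics $$\ddot x(t)+\tfrac3t\,\dot x(t)+Gx(t)=0,\qquad t\in[t_0,\infty),$$ and write a trajectory as $(q,v)=(x,\dot x):[t_0,\infty)\to\mathbb R^N\times\mathbb R^N$. Let $\|\cdot\|_2$ be the Euclidean norm, and the induced operator norm for matrices. Eigenvalues of $G$ are complex eigenvalues. (a) (Instability.) If $G$ has an eigenvalue $\lambda\notin\mathbb R_{\ge0}$, then there are initial conditions $(q_0,v_0)\in\mathbb R^N\times\mathbb R^N$ such that the trajectory with $(q(t_0),v(t_0))=(q_0,v_0)$ grows exponentially: there are constants $c,\alpha>0$ with $\|q(t)\|_2\ge c\,e^{\alpha t}$ for all sufficiently large $t$. Moreover the equilibrium $(0,0)$ is unstable: it is not true that for every $\varepsilon>0$ there is $\delta>0$ such that every trajectory with $\|q(t_0)\|_2+\|v(t_0)\|_2<\delta$ satisfies $\|q(t)\|_2+\|v(t)\|_2<\varepsilon$ for all $t\ge t_0$. (b) (Boundedness and convergence.) If all eigenvalues of $G$ lie in $\mathbb R_{\ge0}$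 and $G$ is diagonalizable, then every trajectory $(q,v)$ is bounded on $[t_0,\infty)$, there is $q^\infty\in\mathbb R^N$ with $q(t)\to q^\infty$, and $v(t)\to0$ as $t\to\infty$. Moreover, for every invertible real or complex matrix $P$ such that $P^{-1}GP$ is diagonal, $$\sup_{t\ge t_0}\|q(t)\|_2\le\kappa(P)\bigl(\|q(t_0)\|_2+C\,\|v(t_0)\|_2\bigr),\qquad \kappa(P)=\|P\|_2\,\|P^{-1}\|_2,$$ where $C=\max\{t_0/2,\ \lambda_{\min}^{-1/2}\}$ with $\lambda_{\min}$ the smallest positive eigenvalue of $G$, and $C=t_0/2$ if $G$ has no positive eigenvalue (i.e. $G=0$). -/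

import Mathlib

open Filter Topology

namespace NAGD

/-- `(q, v)` is a trajectory of `x'' + (3/t) x' + G x = 0` on `[t₀, ∞)`, with position `q = x` and
velocity `v = x'`; derivatives at `t₀` are one-sided. -/
structure IsTrajectory {N : ℕ} (G : Matrix (Fin N) (Fin N) ℝ) (t₀ : ℝ)
    (q v : ℝ → EuclideanSpace ℝ (Fin N)) : Prop where
  deriv_position : ∀ t ∈ Set.Ici t₀, HasDerivWithinAt q (v t) (Set.Ici t₀) t
  deriv_velocity : ∀ t ∈ Set.Ici t₀,
    HasDerivWithinAt v (-((3 / t) • v t) - WithLp.toLp 2 (G.mulVec (q t))) (Set.Ici t₀) t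

/-- `‖q(t)‖` eventually dominates `c * exp (α t)` for some constants `c, α > 0`. -/
def GrowsExponentially {N : ℕ} (q : ℝ → EuclideanSpace ℝ (Fin N)) : Prop :=
  ∃ c > (0 : ℝ), ∃ α > (0 : ℝ), ∀ᶠ t in atTop, c * Real.exp (α * t) ≤ ‖q t‖

/-- Stability of the zero equilibrium, for the initial time `t₀`. -/
def IsStable {N : ℕ} (G : Matrix (Fin N) (Fin N) ℝ) (t₀ : ℝ) : Prop :=
  ∀ ε > (0 : ℝ), ∃ δ > (0 : ℝ), ∀ q v : ℝ → EuclideanSpace ℝ (Fin N), IsTrajectory G t₀ q v →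
    ‖q t₀‖ + ‖v t₀‖ < δ → ∀ t ≥ t₀, ‖q t‖ + ‖v t‖ < ε

/-- The nonnegative real half-line, as a subset of `ℂ`. -/
def nonnegReals : Set ℂ := (fun r : ℝ => (r : ℂ)) '' Set.Ici 0

/-- `lam` is a (complex) eigenvalue of the real matrix `G`. -/
def IsEigenvalue {N : ℕ} (G : Matrix (Fin N) (Fin N) ℝ) (lam : ℂ) : Prop :=
  Module.End.HasEigenvalue (Matrix.toLin' (G.map (fun r : ℝ => (r : ℂ)))) lam

/-- The matrix `P`, with real or complex entries, is invertible and `P⁻¹ G P` is diagonal. -/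
def Diagonalizes {N : ℕ} {𝕜 : Type*} [RCLike 𝕜] (P : Matrix (Fin N) (Fin N) 𝕜)
    (G : Matrix (Fin N) (Fin N) ℝ) : Prop :=
  IsUnit P ∧ (P⁻¹ * G.map (algebraMap ℝ 𝕜) * P).IsDiag

/-- `G` is diagonalizable over `ℂ`. -/
def IsDiagonalizable {N : ℕ} (G : Matrix (Fin N) (Fin N) ℝ) : Prop :=
  ∃ P : Matrix (Fin N) (Fin N) ℂ, Diagonalizes P G

/-- The condition number `‖P‖ ‖P⁻¹‖` in the operator norm induced by the Euclidean norm. -/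
noncomputable def condNumber {N : ℕ} {𝕜 : Type*} [RCLike 𝕜] (P : Matrix (Fin N) (Fin N) 𝕜) : ℝ :=
  ‖Matrix.toEuclideanCLM (n := Fin N) (𝕜 := 𝕜) P‖ *
    ‖Matrix.toEuclideanCLM (n := Fin N) (𝕜 := 𝕜) P⁻¹‖

/-- The positive real eigenvalues of `G`; this set is finite. -/
def positiveEigenvalues {N : ℕ} (G : Matrix (Fin N) (Fin N) ℝ) : Set ℝ :=
  {r : ℝ | 0 < r ∧ IsEigenvalue G (r : ℂ)}

open Classical in
/-- `max {t₀ / 2, lam_min ^ (-1/2)}` with `lam_min` the least positive eigenvalue of `G`, and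
`t₀ / 2` if `G` has no positive eigenvalue. -/
noncomputable def growthConst {N : ℕ} (G : Matrix (Fin N) (Fin N) ℝ) (t₀ : ℝ) : ℝ :=
  if (positiveEigenvalues G).Nonempty then
    max (t₀ / 2) (sInf (positiveEigenvalues G) ^ (-(1 / 2) : ℝ))
  else t₀ / 2

end NAGD

namespace NAGD

/-! ### Damped oscillators -/

/-! For (b), a diagonalizing `P` decouples the system: each coordinate of `P⁻¹ q` solves `y'' +
(3/t) y' + r y = 0` with `r ≥ 0`. If `r > 0`, the decreasing energy `‖y'‖² + r‖y‖²` gives the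
amplitude bound (`norm_position_le_of_pos`), and the decreasing functional `t² r‖y‖² + ‖2y + t y'‖²`
gives `y = O(1/t)` and `y' → 0` (`lyapunov_le`). If `r = 0`, the solution is explicit. Multiplying
back by `P` costs the factor `‖P‖ ‖P⁻¹‖`.

For (a), choose `μ` with `μ² = -lam` and `re μ > 0`. Such a root exists exactly because `lam` is not
a nonnegative real. Without damping, `a = z' + μ z` grows and `b = z' - μ z` decays. The damping
`3/t` is a small perturbation at late times, so the cone `‖a‖² > 4‖b‖²` is preserved and solutions
in it grow exponentially (`IsDampedSolution.growth`). The scalar solution is started at a late time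
`T` and exists on all of `[t₀, ∞)` by global solvability of linear equations. The map `a ↦ Re (a
x)`, with `x` a complex eigenvector, turns it into a real trajectory. Uniqueness then covers every
trajectory with the same data, and rescaling gives instability. -/

/-- `(x, v)` solves `x'' + (3/t) x' + A x = 0` on `[t₀, ∞)`, with `v = x'`. -/
structure IsDampedSolution {E : Type*} [NormedAddCommGroup E] [NormedSpace ℝ E] (A : E → E)
    (t₀ : ℝ) (x v : ℝ → E) : Prop where
  deriv_position : ∀ t ∈ Set.Ici t₀, HasDerivWithinAt x (v t) (Set.Ici t₀) t
  deriv_velocity : ∀ t ∈ Set.Ici t₀,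
    HasDerivWithinAt v (-((3 / t) • v t) - A (x t)) (Set.Ici t₀) t

theorem isTrajectory_iff {N : ℕ} {G : Matrix (Fin N) (Fin N) ℝ} {t₀ : ℝ}
    {q v : ℝ → EuclideanSpace ℝ (Fin N)} :
    IsTrajectory G t₀ q v ↔ IsDampedSolution (fun x => WithLp.toLp 2 (G.mulVec x)) t₀ q v :=
  ⟨fun h => ⟨h.1, h.2⟩, fun h => ⟨h.1, h.2⟩⟩

theorem antitoneOn_Ici_of_deriv {f f' : ℝ → ℝ} {t₀ : ℝ}
    (hf : ∀ t ∈ Set.Ici t₀, HasDerivWithinAt f (f' t) (Set.Ici t₀) t)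
    (hf' : ∀ t ∈ Set.Ici t₀, f' t ≤ 0) : AntitoneOn f (Set.Ici t₀) :=
  antitoneOn_of_hasDerivWithinAt_nonpos (f' := f') (convex_Ici t₀)
    (fun t ht => (hf t ht).continuousWithinAt)
    (fun t ht => (hf t (interior_subset ht)).mono interior_subset)
    (fun t ht => hf' t (interior_subset ht))

theorem eq_of_deriv_eq_zero {E : Type*} [NormedAddCommGroup E] [NormedSpace ℝ E] {f : ℝ → E}
    {t₀ : ℝ} (hf : ∀ t ∈ Set.Ici t₀, HasDerivWithinAt f 0 (Set.Ici t₀) t) {t : ℝ} (ht : t₀ ≤ t) :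
    f t = f t₀ :=
  constant_of_has_deriv_right_zero (b := t)
    (fun s hs => ((hf s hs.1).mono Set.Icc_subset_Ici_self).continuousWithinAt)
    (fun s hs => (hf s hs.1).mono (Set.Ici_subset_Ici.2 hs.1)) t ⟨ht, le_rfl⟩

theorem IsDampedSolution.mono {E : Type*} [NormedAddCommGroup E] [NormedSpace ℝ E] {A : E → E}
    {t₀ t₁ : ℝ} {x v : ℝ → E} (h : IsDampedSolution A t₀ x v) (ht : t₀ ≤ t₁) :
    IsDampedSolution A t₁ x v :=
  ⟨fun t h' => (h.1 t (ht.trans h')).mono (Set.Ici_subset_Ici.2 ht),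
    fun t h' => (h.2 t (ht.trans h')).mono (Set.Ici_subset_Ici.2 ht)⟩

/-- The equation is linear, so any real-linear map intertwining the two forces transports solutions.
This serves to project onto modes, to embed scalar solutions and to rescale trajectories. -/
theorem IsDampedSolution.comp {E F : Type*} [NormedAddCommGroup E] [NormedSpace ℝ E]
    [NormedAddCommGroup F] [NormedSpace ℝ F] {A : E → E} {B : F → F}
    {t₀ : ℝ} {x v : ℝ → E} (h : IsDampedSolution A t₀ x v) (L : E →L[ℝ] F)
    (hL : ∀ a, L (A a) = B (L a)) :
    IsDampedSolution B t₀ (fun t => L (x t)) (fun t => L (v t)) := by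
  refine ⟨fun t ht => L.hasFDerivAt.comp_hasDerivWithinAt t (h.1 t ht), fun t ht => ?_⟩
  have := L.hasFDerivAt.comp_hasDerivWithinAt t (h.2 t ht)
  simp only [map_sub, map_neg, map_smul, hL] at this
  exact this

section Oscillator

variable {E : Type*} [NormedAddCommGroup E] [InnerProductSpace ℝ E] {lam t₀ : ℝ} {x v : ℝ → E}

theorem IsDampedSolution.energy_le (h : IsDampedSolution (fun a => lam • a) t₀ x v) (ht₀ : 0 < t₀)
    {t : ℝ} (ht : t₀ ≤ t) :
    ‖v t‖ ^ 2 + lam * ‖x t‖ ^ 2 ≤ ‖v t₀‖ ^ 2 + lam * ‖x t₀‖ ^ 2 := by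
  refine antitoneOn_Ici_of_deriv (f := fun t => ‖v t‖ ^ 2 + lam * ‖x t‖ ^ 2)
    (f' := fun t => -(6 / t) * ‖v t‖ ^ 2) (fun s hs => ?_) (fun s hs => ?_)
    Set.self_mem_Ici (Set.mem_Ici.2 ht) ht
  · refine ((h.2 s hs).norm_sq.add ((h.1 s hs).norm_sq.const_mul lam)).congr_deriv ?_
    simp only [inner_sub_right, inner_neg_right, inner_smul_right, real_inner_self_eq_norm_sq,
      real_inner_comm (v s) (x s)]
    ring
  · have : 0 < s := ht₀.trans_le hs
    have : 0 ≤ 6 / s * ‖v s‖ ^ 2 := by positivity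
    linarith

/-- The weights are chosen so that the damping cancels: `(2x + t v)' = -t lam x`. The cross terms
then cancel too, and the derivative is `-2 t lam ‖x‖²`. -/
theorem IsDampedSolution.lyapunov_le (h : IsDampedSolution (fun a => lam • a) t₀ x v)
    (ht₀ : 0 < t₀) (hlam : 0 ≤ lam) {t : ℝ} (ht : t₀ ≤ t) :
    t ^ 2 * (lam * ‖x t‖ ^ 2) + ‖(2 : ℝ) • x t + t • v t‖ ^ 2 ≤
      t₀ ^ 2 * (lam * ‖x t₀‖ ^ 2) + ‖(2 : ℝ) • x t₀ + t₀ • v t₀‖ ^ 2 := by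
  refine antitoneOn_Ici_of_deriv
    (f := fun t => t ^ 2 * (lam * ‖x t‖ ^ 2) + ‖(2 : ℝ) • x t + t • v t‖ ^ 2)
    (f' := fun t => -(2 * t * lam * ‖x t‖ ^ 2)) (fun s hs => ?_) (fun s hs => ?_)
    Set.self_mem_Ici (Set.mem_Ici.2 ht) ht
  · have hs0 : s ≠ 0 := (ht₀.trans_le hs).ne'
    have h1 := ((hasDerivWithinAt_id s (Set.Ici t₀)).pow 2).mul
      ((h.1 s hs).norm_sq.const_mul lam)
    have h2 := (((h.1 s hs).const_smul (2 : ℝ)).add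
      ((hasDerivWithinAt_id s (Set.Ici t₀)).smul (h.2 s hs))).norm_sq
    refine (h1.add h2).congr_deriv ?_
    have e : (2 : ℝ) • v s + (id s • (-((3 / s) • v s) - lam • x s) + (1 : ℝ) • v s) =
        -((s * lam) • x s) := by
      simp only [id, smul_sub, smul_neg, smul_smul, mul_div_cancel₀ _ hs0]
      module
    simp only [Pi.add_apply, Pi.smul_apply, Pi.smul_apply', e]
    simp only [id, inner_add_left, inner_neg_right, inner_smul_right, inner_smul_left,
      real_inner_self_eq_norm_sq, real_inner_comm (v s) (x s)]
    simp
    ring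
  · have : 0 < s := ht₀.trans_le hs
    have : 0 ≤ 2 * s * lam * ‖x s‖ ^ 2 := by positivity
    linarith

theorem IsDampedSolution.norm_position_le_of_pos (h : IsDampedSolution (fun a => lam • a) t₀ x v)
    (ht₀ : 0 < t₀) (hlam : 0 < lam) {t : ℝ} (ht : t₀ ≤ t) :
    ‖x t‖ ≤ ‖x t₀‖ + lam ^ (-(1 / 2) : ℝ) * ‖v t₀‖ := by
  have e : lam * (lam ^ (-(1 / 2) : ℝ)) ^ 2 = 1 := by
    rw [← Real.rpow_natCast, ← Real.rpow_mul hlam.le]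
    norm_num [Real.rpow_neg_one, hlam.ne']
  have hc : 0 ≤ lam ^ (-(1 / 2) : ℝ) := by positivity
  set c := lam ^ (-(1 / 2) : ℝ)
  refine le_of_sq_le_sq ?_ (by positivity)
  have h1 := h.energy_le ht₀ ht
  have h2 : lam * ‖x t‖ ^ 2 ≤ lam * (‖x t₀‖ + c * ‖v t₀‖) ^ 2 := by
    have : lam * (‖x t₀‖ + c * ‖v t₀‖) ^ 2 =
        lam * ‖x t₀‖ ^ 2 + 2 * lam * c * ‖x t₀‖ * ‖v t₀‖ + (lam * c ^ 2) * ‖v t₀‖ ^ 2 := by ring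
    rw [this, e]
    have : 0 ≤ 2 * lam * c * ‖x t₀‖ * ‖v t₀‖ := by positivity
    nlinarith [sq_nonneg ‖v t‖]
  exact le_of_mul_le_mul_left h2 hlam

theorem IsDampedSolution.velocity_eq_of_zero (h : IsDampedSolution (fun _ => 0) t₀ x v)
    (ht₀ : 0 < t₀) {t : ℝ} (ht : t₀ ≤ t) : v t = (t₀ / t) ^ 3 • v t₀ := by
  have h1 : t ^ 3 • v t = t₀ ^ 3 • v t₀ := by
    -- `t³` is the integrating factor of `v' = -(3/t) v`.
    refine eq_of_deriv_eq_zero (f := fun s => s ^ 3 • v s) (fun s hs => ?_) ht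
    have hs0 : s ≠ 0 := (ht₀.trans_le hs).ne'
    refine (((hasDerivWithinAt_id s (Set.Ici t₀)).pow 3).smul (h.2 s hs)).congr_deriv ?_
    have e : s ^ 3 * (3 / s) = 3 * s ^ 2 := by field_simp
    simp [smul_smul, e]
  have ht0 : t ≠ 0 := (ht₀.trans_le ht).ne'
  rw [div_pow, div_eq_inv_mul, mul_smul, ← h1, smul_smul, inv_mul_cancel₀ (pow_ne_zero _ ht0),
    one_smul]

theorem IsDampedSolution.position_eq_of_zero (h : IsDampedSolution (fun _ => 0) t₀ x v)
    (ht₀ : 0 < t₀) {t : ℝ} (ht : t₀ ≤ t) :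
    x t = x t₀ + (t₀ / 2 * (1 - (t₀ / t) ^ 2)) • v t₀ := by
  have h1 : x t + (t / 2) • v t = x t₀ + (t₀ / 2) • v t₀ := by
    refine eq_of_deriv_eq_zero (f := fun s => x s + (s / 2) • v s) (fun s hs => ?_) ht
    have hs0 : s ≠ 0 := (ht₀.trans_le hs).ne'
    refine ((h.1 s hs).add
      (((hasDerivWithinAt_id s (Set.Ici t₀)).div_const 2).smul (h.2 s hs))).congr_deriv ?_
    have e : s / 2 * (3 / s) = 3 / 2 := by field_simp
    simp only [id, sub_zero, smul_neg, smul_smul, e]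
    module
  have ht0 : t ≠ 0 := (ht₀.trans_le ht).ne'
  have e : t / 2 * (t₀ / t) ^ 3 = t₀ / 2 * (t₀ / t) ^ 2 := by field_simp
  rw [h.velocity_eq_of_zero ht₀ ht, smul_smul, e] at h1
  rw [eq_sub_of_add_eq h1]
  module

theorem IsDampedSolution.norm_position_le_of_zero (h : IsDampedSolution (fun _ => 0) t₀ x v)
    (ht₀ : 0 < t₀) {t : ℝ} (ht : t₀ ≤ t) : ‖x t‖ ≤ ‖x t₀‖ + t₀ / 2 * ‖v t₀‖ := by
  rw [h.position_eq_of_zero ht₀ ht]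
  refine (norm_add_le _ _).trans ?_
  have hd : t₀ / t ≤ 1 := (div_le_one (ht₀.trans_le ht)).2 ht
  have hd0 : 0 ≤ t₀ / t := (div_pos ht₀ (ht₀.trans_le ht)).le
  have h2 : (t₀ / t) ^ 2 ≤ 1 := pow_le_one₀ hd0 hd
  rw [norm_smul, Real.norm_of_nonneg (mul_nonneg (by positivity) (by linarith))]
  gcongr
  nlinarith [sq_nonneg (t₀ / t)]

theorem tendsto_zero_of_mul_norm_le {E : Type*} [SeminormedAddCommGroup E] {t₀ : ℝ} {f : ℝ → E}
    {M : ℝ} (hf : ∀ t ≥ t₀, t * ‖f t‖ ≤ M) :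
    Tendsto f atTop (𝓝 0) := by
  refine squeeze_zero_norm' (a := fun t => M / t) ?_ (tendsto_const_nhds.div_atTop tendsto_id)
  filter_upwards [eventually_ge_atTop t₀, eventually_gt_atTop 0] with t ht ht0
  rw [le_div_iff₀ ht0, mul_comm]
  exact hf t ht

theorem IsDampedSolution.exists_tendsto (h : IsDampedSolution (fun a => lam • a) t₀ x v)
    (ht₀ : 0 < t₀) (hlam : 0 ≤ lam) :
    (∃ l, Tendsto x atTop (𝓝 l)) ∧ Tendsto v atTop (𝓝 0) := by
  rcases hlam.eq_or_lt with rfl | hpos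
  · simp only [zero_smul] at h
    have hdiv : Tendsto (fun t : ℝ => t₀ / t) atTop (𝓝 0) :=
      tendsto_const_nhds.div_atTop tendsto_id
    refine ⟨⟨x t₀ + (t₀ / 2 * (1 - 0 ^ 2)) • v t₀, ?_⟩, ?_⟩
    · refine Tendsto.congr' ?_ (((((hdiv.pow 2).const_sub 1).const_mul (t₀ / 2)).smul_const
        (v t₀)).const_add (x t₀))
      filter_upwards [eventually_ge_atTop t₀] with t ht
      exact (h.position_eq_of_zero ht₀ ht).symm
    · have := (hdiv.pow 3).smul_const (v t₀)
      rw [zero_pow three_ne_zero, zero_smul] at this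
      refine Tendsto.congr' ?_ this
      filter_upwards [eventually_ge_atTop t₀] with t ht
      exact (h.velocity_eq_of_zero ht₀ ht).symm
  · set Φ := t₀ ^ 2 * (lam * ‖x t₀‖ ^ 2) + ‖(2 : ℝ) • x t₀ + t₀ • v t₀‖ ^ 2
    have hx : Tendsto x atTop (𝓝 0) := by
      refine tendsto_zero_of_mul_norm_le (t₀ := t₀) (M := √(Φ / lam)) (fun t ht => ?_)
      refine Real.le_sqrt_of_sq_le ((le_div_iff₀ hpos).2 ?_)
      have := h.lyapunov_le ht₀ hlam ht
      nlinarith [sq_nonneg ‖(2 : ℝ) • x t + t • v t‖]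
    refine ⟨⟨0, hx⟩, ?_⟩
    -- The Lyapunov bound controls `2x + t v`, so `v = (2x + t v)/t - (2/t) x` tends to zero.
    have hxv : Tendsto (fun t => (1 / t) • ((2 : ℝ) • x t + t • v t)) atTop (𝓝 0) := by
      refine tendsto_zero_of_mul_norm_le (t₀ := t₀) (M := √Φ) (fun t ht => ?_)
      have ht0 : 0 < t := ht₀.trans_le ht
      rw [norm_smul, ← mul_assoc, Real.norm_of_nonneg (by positivity), mul_one_div_cancel ht0.ne',
        one_mul]
      refine Real.le_sqrt_of_sq_le ?_
      have := h.lyapunov_le ht₀ hlam ht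
      have : 0 ≤ t ^ 2 * (lam * ‖x t‖ ^ 2) := by positivity
      linarith
    have hdiv : Tendsto (fun t : ℝ => 2 / t) atTop (𝓝 0) :=
      tendsto_const_nhds.div_atTop tendsto_id
    have := hxv.sub (hdiv.smul hx)
    rw [smul_zero, sub_zero] at this
    refine Tendsto.congr' ?_ this
    filter_upwards [eventually_gt_atTop 0] with t ht
    rw [smul_add, smul_smul, smul_smul, one_div_mul_cancel ht.ne', one_smul, one_div_mul_eq_div,
      add_sub_cancel_left]

end Oscillator

/-! ### Diagonalizable dynamics -/

section Diagonalizable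

variable {N : ℕ} {𝕜 : Type*} [RCLike 𝕜] {P : Matrix (Fin N) (Fin N) 𝕜}
  {G : Matrix (Fin N) (Fin N) ℝ} {t₀ : ℝ} {q v : ℝ → EuclideanSpace ℝ (Fin N)}

/-- Eigenvalues of `G` are complex by definition, while the diagonal entries live in `𝕜`. This
embedding lets the two be compared. -/
theorem exists_ringHom_complex (𝕜 : Type*) [RCLike 𝕜] :
    ∃ φ : 𝕜 →+* ℂ, ∀ r : ℝ, φ (r : 𝕜) = (r : ℂ) := by
  rcases RCLike.I_eq_zero_or_im_I_eq_one (K := 𝕜) with h | h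
  · exact ⟨Complex.ofRealHom.comp (RCLike.realRingEquiv h).toRingHom, fun r => by
      simp [RCLike.realRingEquiv]⟩
  · exact ⟨(RCLike.complexRingEquiv h).toRingHom, fun r => by
      simp [RCLike.complexRingEquiv]⟩

/-- The diagonal entries of `P⁻¹ G P`. -/
noncomputable def diagEntry (P : Matrix (Fin N) (Fin N) 𝕜) (G : Matrix (Fin N) (Fin N) ℝ)
    (i : Fin N) : 𝕜 :=
  (P⁻¹ * G.map (algebraMap ℝ 𝕜) * P) i i

theorem Diagonalizes.mul_eq (h : Diagonalizes P G) :
    G.map (algebraMap ℝ 𝕜) * P = P * Matrix.diagonal (diagEntry P G) := by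
  have hP : IsUnit P.det := (Matrix.isUnit_iff_isUnit_det P).1 h.1
  have e : Matrix.diagonal (diagEntry P G) = P⁻¹ * G.map (algebraMap ℝ 𝕜) * P :=
    h.2.diagonal_diag
  rw [e, ← mul_assoc, ← mul_assoc, Matrix.mul_nonsing_inv _ hP, one_mul]

theorem Diagonalizes.inv_mul_eq (h : Diagonalizes P G) :
    P⁻¹ * G.map (algebraMap ℝ 𝕜) = Matrix.diagonal (diagEntry P G) * P⁻¹ := by
  have hP : IsUnit P.det := (Matrix.isUnit_iff_isUnit_det P).1 h.1
  have e : Matrix.diagonal (diagEntry P G) = P⁻¹ * G.map (algebraMap ℝ 𝕜) * P :=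
    h.2.diagonal_diag
  rw [e, mul_assoc, Matrix.mul_nonsing_inv _ hP, mul_one]

theorem Diagonalizes.isEigenvalue (h : Diagonalizes P G) {φ : 𝕜 →+* ℂ}
    (hφ : ∀ r : ℝ, φ (r : 𝕜) = (r : ℂ)) (i : Fin N) : IsEigenvalue G (φ (diagEntry P G i)) := by
  have hP : IsUnit P.det := (Matrix.isUnit_iff_isUnit_det P).1 h.1
  refine Module.End.hasEigenvalue_of_hasEigenvector (x := fun j => φ (P j i))
    ⟨Module.End.mem_eigenspace_iff.2 ?_, fun h0 => ?_⟩
  · ext j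
    have := congrArg φ (congrFun (congrFun h.mul_eq j) i)
    rw [Matrix.mul_diagonal, Matrix.mul_apply, map_sum] at this
    simp only [map_mul, Matrix.map_apply, RCLike.algebraMap_eq_ofReal, hφ] at this
    simp only [Matrix.toLin'_apply, Matrix.mulVec, dotProduct, Matrix.map_apply, this,
      Pi.smul_apply, smul_eq_mul, mul_comm]
  · refine hP.ne_zero (Matrix.det_eq_zero_of_column_eq_zero i fun j => ?_)
    exact (map_eq_zero φ).1 (congrFun h0 j)

theorem Diagonalizes.exists_nonneg (h : Diagonalizes P G)
    (hG : ∀ lam : ℂ, IsEigenvalue G lam → lam ∈ nonnegReals) (i : Fin N) :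
    ∃ r : ℝ, 0 ≤ r ∧ diagEntry P G i = (r : 𝕜) ∧ IsEigenvalue G (r : ℂ) := by
  obtain ⟨φ, hφ⟩ := exists_ringHom_complex 𝕜
  have hi := h.isEigenvalue hφ i
  obtain ⟨r, hr, e⟩ := hG _ hi
  exact ⟨r, hr, φ.injective (by rw [hφ]; exact e.symm), by rwa [← e] at hi⟩

/-- The inclusion of real vectors into vectors over `𝕜`. -/
noncomputable def toRCLike (𝕜 : Type*) [RCLike 𝕜] (x : EuclideanSpace ℝ (Fin N)) :
    EuclideanSpace 𝕜 (Fin N) :=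
  WithLp.toLp 2 fun i => (x i : 𝕜)

theorem norm_toRCLike (x : EuclideanSpace ℝ (Fin N)) : ‖toRCLike 𝕜 x‖ = ‖x‖ := by
  simp [toRCLike, EuclideanSpace.norm_eq]

/-- The coordinates `P⁻¹ x`. -/
noncomputable def modalCoord (P : Matrix (Fin N) (Fin N) 𝕜) (x : EuclideanSpace ℝ (Fin N)) :
    EuclideanSpace 𝕜 (Fin N) :=
  Matrix.toEuclideanCLM (n := Fin N) (𝕜 := 𝕜) P⁻¹ (toRCLike 𝕜 x)

/-- The coordinate functions of `modalCoord`. -/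
noncomputable def modalCoordCLM (P : Matrix (Fin N) (Fin N) 𝕜) (i : Fin N) :
    EuclideanSpace ℝ (Fin N) →L[ℝ] 𝕜 :=
  LinearMap.toContinuousLinearMap
    { toFun := fun x => ∑ j, P⁻¹ i j * (x j : 𝕜)
      map_add' := fun x y => by simp [mul_add, Finset.sum_add_distrib]
      map_smul' := fun c x => by
        simp only [PiLp.smul_apply, smul_eq_mul, RCLike.ofReal_mul, RingHom.id_apply,
          Finset.smul_sum, RCLike.real_smul_eq_coe_mul]
        exact Finset.sum_congr rfl fun j _ => by ring }

theorem modalCoordCLM_apply (P : Matrix (Fin N) (Fin N) 𝕜) (i : Fin N)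
    (x : EuclideanSpace ℝ (Fin N)) : modalCoordCLM P i x = modalCoord P x i := by
  simp [modalCoord, modalCoordCLM, toRCLike, Matrix.mulVec, dotProduct]

theorem norm_modalCoord_le (P : Matrix (Fin N) (Fin N) 𝕜) (x : EuclideanSpace ℝ (Fin N)) :
    ‖modalCoord P x‖ ≤ ‖Matrix.toEuclideanCLM (n := Fin N) (𝕜 := 𝕜) P⁻¹‖ * ‖x‖ := by
  rw [← norm_toRCLike (𝕜 := 𝕜) x]
  exact ContinuousLinearMap.le_opNorm _ _

theorem toEuclideanCLM_modalCoord (hP : IsUnit P) (x : EuclideanSpace ℝ (Fin N)) :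
    Matrix.toEuclideanCLM (n := Fin N) (𝕜 := 𝕜) P (modalCoord P x) = toRCLike 𝕜 x := by
  rw [modalCoord, ← mul_apply_eq_comp, ← map_mul,
    Matrix.mul_nonsing_inv _ ((Matrix.isUnit_iff_isUnit_det P).1 hP), map_one,
    one_apply_eq_self]

theorem modalCoord_mulVec (h : Diagonalizes P G) (x : EuclideanSpace ℝ (Fin N)) (i : Fin N) :
    modalCoord P (WithLp.toLp 2 (G.mulVec x)) i = diagEntry P G i * modalCoord P x i := by
  have e : (toRCLike 𝕜 (WithLp.toLp 2 (G.mulVec x))).ofLp =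
      (G.map (algebraMap ℝ 𝕜)).mulVec (toRCLike 𝕜 x).ofLp := by
    ext j
    simp [toRCLike, Matrix.mulVec, dotProduct]
  simp only [modalCoord, Matrix.ofLp_toEuclideanCLM, e, Matrix.mulVec_mulVec, h.inv_mul_eq]
  rw [← Matrix.mulVec_mulVec, Matrix.mulVec_diagonal]

theorem IsTrajectory.modalCoord_isDampedSolution (h : IsTrajectory G t₀ q v)
    (hP : Diagonalizes P G) {i : Fin N} {r : ℝ} (hr : diagEntry P G i = (r : 𝕜)) :
    IsDampedSolution (fun a : 𝕜 => r • a) t₀ (fun t => modalCoord P (q t) i)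
      (fun t => modalCoord P (v t) i) := by
  simp only [← modalCoordCLM_apply]
  refine (isTrajectory_iff.1 h).comp (modalCoordCLM P i) fun a => ?_
  rw [modalCoordCLM_apply, modalCoord_mulVec hP, hr, modalCoordCLM_apply,
    RCLike.real_smul_eq_coe_mul]

theorem positiveEigenvalues_finite (G : Matrix (Fin N) (Fin N) ℝ) :
    (positiveEigenvalues G).Finite := by
  refine Set.Finite.subset (Set.Finite.preimage Complex.ofReal_injective.injOn
    (Module.End.finite_hasEigenvalue (Matrix.toLin' (G.map (fun r : ℝ => (r : ℂ)))))) ?_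
  exact fun r hr => hr.2

theorem growthConst_nonneg (G : Matrix (Fin N) (Fin N) ℝ) (ht₀ : 0 < t₀) :
    0 ≤ growthConst G t₀ := by
  unfold growthConst
  split_ifs
  · exact le_max_of_le_left (by positivity)
  · positivity

theorem half_le_growthConst (G : Matrix (Fin N) (Fin N) ℝ) (t₀ : ℝ) :
    t₀ / 2 ≤ growthConst G t₀ := by
  unfold growthConst
  split_ifs
  · exact le_max_left _ _
  · exact le_rfl

theorem rpow_le_growthConst {r : ℝ} (hr : r ∈ positiveEigenvalues G) (t₀ : ℝ) :
    r ^ (-(1 / 2) : ℝ) ≤ growthConst G t₀ := by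
  have hne : (positiveEigenvalues G).Nonempty := ⟨r, hr⟩
  -- By finiteness the infimum is attained, hence positive, as the antitonicity of `r ↦ r ^ (-1/2)`
  -- requires.
  have hmem := hne.csInf_mem (positiveEigenvalues_finite G)
  rw [growthConst, if_pos hne]
  refine le_max_of_le_right (Real.rpow_le_rpow_of_nonpos hmem.1 ?_ (by norm_num))
  exact csInf_le (positiveEigenvalues_finite G).bddBelow hr

theorem norm_modalCoord_apply_le (ht₀ : 0 < t₀) (h : IsTrajectory G t₀ q v)
    (hP : Diagonalizes P G) (hG : ∀ lam : ℂ, IsEigenvalue G lam → lam ∈ nonnegReals) (i : Fin N)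
    {t : ℝ} (ht : t₀ ≤ t) :
    ‖modalCoord P (q t) i‖ ≤
      ‖modalCoord P (q t₀) i‖ + growthConst G t₀ * ‖modalCoord P (v t₀) i‖ := by
  obtain ⟨r, hr0, hr, hre⟩ := hP.exists_nonneg hG i
  have hs := h.modalCoord_isDampedSolution hP hr
  rcases hr0.eq_or_lt with rfl | hpos
  · simp only [zero_smul] at hs
    refine (hs.norm_position_le_of_zero ht₀ ht).trans ?_
    gcongr
    exact half_le_growthConst G t₀
  · refine (hs.norm_position_le_of_pos ht₀ hpos ht).trans ?_
    gcongr
    exact rpow_le_growthConst ⟨hpos, hre⟩ t₀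

/-- Minkowski's inequality for the vectors of moduli. Summing the modal bounds this way loses no
dimensional constant. -/
theorem norm_le_add_mul_of_forall_le {ι : Type*} [Fintype ι] {x y z : EuclideanSpace 𝕜 ι} {C : ℝ}
    (hC : 0 ≤ C) (h : ∀ i, ‖x i‖ ≤ ‖y i‖ + C * ‖z i‖) : ‖x‖ ≤ ‖y‖ + C * ‖z‖ := by
  let n : EuclideanSpace 𝕜 ι → EuclideanSpace ℝ ι := fun w => WithLp.toLp 2 fun i => ‖w i‖
  have hn : ∀ w, ‖n w‖ = ‖w‖ := fun w => by simp [n, EuclideanSpace.norm_eq]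
  have hx : ‖x‖ ≤ ‖n y + C • n z‖ := by
    rw [EuclideanSpace.norm_eq, EuclideanSpace.norm_eq]
    refine Real.sqrt_le_sqrt (Finset.sum_le_sum fun i _ => ?_)
    gcongr
    exact (h i).trans (Real.le_norm_self _)
  refine hx.trans ((norm_add_le _ _).trans_eq ?_)
  rw [norm_smul, Real.norm_of_nonneg hC, hn, hn]

theorem IsTrajectory.norm_position_le (ht₀ : 0 < t₀) (h : IsTrajectory G t₀ q v)
    (hP : Diagonalizes P G) (hG : ∀ lam : ℂ, IsEigenvalue G lam → lam ∈ nonnegReals)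
    {t : ℝ} (ht : t₀ ≤ t) :
    ‖q t‖ ≤ condNumber P * (‖q t₀‖ + growthConst G t₀ * ‖v t₀‖) := by
  have hC := growthConst_nonneg G ht₀
  calc ‖q t‖ = ‖Matrix.toEuclideanCLM (n := Fin N) (𝕜 := 𝕜) P (modalCoord P (q t))‖ := by
        rw [toEuclideanCLM_modalCoord hP.1, norm_toRCLike]
    _ ≤ ‖Matrix.toEuclideanCLM (n := Fin N) (𝕜 := 𝕜) P‖ * ‖modalCoord P (q t)‖ :=
        ContinuousLinearMap.le_opNorm _ _
    _ ≤ ‖Matrix.toEuclideanCLM (n := Fin N) (𝕜 := 𝕜) P‖ *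
          (‖modalCoord P (q t₀)‖ + growthConst G t₀ * ‖modalCoord P (v t₀)‖) := by
        gcongr
        exact norm_le_add_mul_of_forall_le hC
          fun i => norm_modalCoord_apply_le ht₀ h hP hG i ht
    _ ≤ ‖Matrix.toEuclideanCLM (n := Fin N) (𝕜 := 𝕜) P‖ *
          (‖Matrix.toEuclideanCLM (n := Fin N) (𝕜 := 𝕜) P⁻¹‖ * ‖q t₀‖ + growthConst G t₀ *
            (‖Matrix.toEuclideanCLM (n := Fin N) (𝕜 := 𝕜) P⁻¹‖ * ‖v t₀‖)) := by
        gcongr <;> exact norm_modalCoord_le _ _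
    _ = _ := by rw [condNumber]; ring

/-- The map `y ↦ Re (P y)` is a continuous left inverse of `modalCoord`, so modal limits yield a
limit in the real space. -/
theorem continuous_re_apply_toEuclideanCLM (P : Matrix (Fin N) (Fin N) 𝕜) :
    Continuous fun y : EuclideanSpace 𝕜 (Fin N) => (WithLp.toLp 2 fun i =>
      RCLike.re (Matrix.toEuclideanCLM (n := Fin N) (𝕜 := 𝕜) P y i) : EuclideanSpace ℝ (Fin N)) := by
  refine (PiLp.continuous_toLp 2 _).comp (continuous_pi fun i => RCLike.continuous_re.comp ?_)
  exact (PiLp.continuous_apply 2 _ i).comp (ContinuousLinearMap.continuous _)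

theorem re_toEuclideanCLM_modalCoord (hP : IsUnit P) (x : EuclideanSpace ℝ (Fin N)) :
    (WithLp.toLp 2 fun i => RCLike.re
      (Matrix.toEuclideanCLM (n := Fin N) (𝕜 := 𝕜) P (modalCoord P x) i)) = x := by
  rw [toEuclideanCLM_modalCoord hP]
  ext i
  simp [toRCLike]

theorem IsTrajectory.exists_tendsto (ht₀ : 0 < t₀) (h : IsTrajectory G t₀ q v)
    (hP : Diagonalizes P G) (hG : ∀ lam : ℂ, IsEigenvalue G lam → lam ∈ nonnegReals) :
    (∃ qlim, Tendsto q atTop (𝓝 qlim)) ∧ Tendsto v atTop (𝓝 0) := by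
  have key : ∀ i, (∃ l, Tendsto (fun t => modalCoord P (q t) i) atTop (𝓝 l)) ∧
      Tendsto (fun t => modalCoord P (v t) i) atTop (𝓝 0) := fun i => by
    obtain ⟨r, hr0, hr, -⟩ := hP.exists_nonneg hG i
    exact (h.modalCoord_isDampedSolution hP hr).exists_tendsto ht₀ hr0
  have lift : ∀ (f : ℝ → EuclideanSpace ℝ (Fin N)) (l : Fin N → 𝕜),
      (∀ i, Tendsto (fun t => modalCoord P (f t) i) atTop (𝓝 (l i))) →
      Tendsto f atTop (𝓝 (WithLp.toLp 2 fun i => RCLike.re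
        (Matrix.toEuclideanCLM (n := Fin N) (𝕜 := 𝕜) P (WithLp.toLp 2 l) i))) := by
    intro f l hf
    have h1 : Tendsto (fun t => modalCoord P (f t)) atTop (𝓝 (WithLp.toLp 2 l)) :=
      ((PiLp.continuous_toLp 2 _).tendsto l).comp (tendsto_pi_nhds.2 hf)
    refine (((continuous_re_apply_toEuclideanCLM P).tendsto _).comp h1).congr fun t => ?_
    exact re_toEuclideanCLM_modalCoord hP.1 (f t)
  choose l hl using fun i => (key i).1
  refine ⟨⟨_, lift q l hl⟩, ?_⟩
  have := lift v (fun _ => 0) fun i => (key i).2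
  have e : (WithLp.toLp 2 fun i => RCLike.re (Matrix.toEuclideanCLM (n := Fin N) (𝕜 := 𝕜) P
      (WithLp.toLp 2 fun _ => 0) i) : EuclideanSpace ℝ (Fin N)) = 0 := by
    ext i
    simp [Matrix.mulVec, dotProduct]
  rwa [e] at this

theorem exists_bound_of_tendsto {E : Type*} [NormedAddCommGroup E] {f : ℝ → E} {l : E}
    (hf : ContinuousOn f (Set.Ici t₀)) (hl : Tendsto f atTop (𝓝 l)) :
    ∃ M, ∀ t ≥ t₀, ‖f t‖ ≤ M := by
  obtain ⟨T, hT⟩ := eventually_atTop.1 (hl.norm.eventually_le_const (lt_add_one ‖l‖))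
  obtain ⟨M, hM⟩ := isCompact_Icc.exists_bound_of_continuousOn
    (hf.mono (Set.Icc_subset_Ici_self : Set.Icc t₀ T ⊆ Set.Ici t₀))
  refine ⟨max M (‖l‖ + 1), fun t ht => ?_⟩
  rcases le_total t T with h | h
  · exact le_max_of_le_left (hM t ⟨ht, h⟩)
  · exact le_max_of_le_right (hT t h)

theorem IsTrajectory.exists_bound (ht₀ : 0 < t₀) (h : IsTrajectory G t₀ q v)
    (hP : Diagonalizes P G) (hG : ∀ lam : ℂ, IsEigenvalue G lam → lam ∈ nonnegReals) :
    ∃ M : ℝ, ∀ t ≥ t₀, ‖q t‖ ≤ M ∧ ‖v t‖ ≤ M := by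
  obtain ⟨⟨l, hl⟩, hv⟩ := h.exists_tendsto ht₀ hP hG
  obtain ⟨M, hM⟩ := exists_bound_of_tendsto
    (fun t ht => (h.deriv_position t ht).continuousWithinAt) hl
  obtain ⟨M', hM'⟩ := exists_bound_of_tendsto
    (fun t ht => (h.deriv_velocity t ht).continuousWithinAt) hv
  exact ⟨max M M', fun t ht => ⟨le_max_of_le_left (hM t ht), le_max_of_le_right (hM' t ht)⟩⟩

end Diagonalizable

/-! ### Global solutions of linear equations -/

section LinearODE

open BoundedContinuousFunction

theorem integral_exp_abs_le {k : ℝ} (hk : 0 < k) (t : ℝ) :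
    |∫ s in (0 : ℝ)..t, Real.exp (k * |s|)| ≤ Real.exp (k * |t|) / k := by
  have key : ∀ t, 0 ≤ t → |∫ s in (0 : ℝ)..t, Real.exp (k * |s|)| ≤ Real.exp (k * |t|) / k := by
    intro t ht
    have e : ∫ s in (0 : ℝ)..t, Real.exp (k * |s|) = ∫ s in (0 : ℝ)..t, Real.exp (k * s) := by
      refine intervalIntegral.integral_congr fun s hs => ?_
      rw [Set.uIcc_of_le ht] at hs
      simp only [abs_of_nonneg hs.1]
    rw [abs_of_nonneg (intervalIntegral.integral_nonneg ht fun s _ => (Real.exp_pos _).le), e,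
      intervalIntegral.integral_comp_mul_left (fun s => Real.exp s) hk.ne', integral_exp,
      abs_of_nonneg ht, smul_eq_mul, div_eq_inv_mul]
    gcongr
    linarith [Real.exp_pos (k * 0)]
  rcases le_total 0 t with ht | ht
  · exact key t ht
  · have h1 := key (-t) (neg_nonneg.2 ht)
    have h2 := intervalIntegral.integral_comp_neg (a := t) (b := 0)
      (fun s => Real.exp (k * |s|))
    rw [neg_zero] at h2
    simp only [abs_neg] at h1 h2
    rwa [intervalIntegral.integral_symm, abs_neg, h2]

variable {E : Type*} [NormedAddCommGroup E] [NormedSpace ℝ E]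

/-- The exponent `2K` makes integration gain `1/(2K)` against the bound `K` on `A`. The resulting
factor `1/2` is the contraction constant below. -/
theorem norm_integral_weighted_le {A : ℝ → E →L[ℝ] E} {K : ℝ} (hK : 0 < K)
    (hA : ∀ t, ‖A t‖ ≤ K) {y : ℝ → E} {d : ℝ} (hy : ∀ t, ‖y t‖ ≤ d) (t : ℝ) :
    ‖∫ s in (0 : ℝ)..t, Real.exp (2 * K * |s|) • A s (y s)‖ ≤
      d / 2 * Real.exp (2 * K * |t|) := by
  have hd : 0 ≤ d := (norm_nonneg _).trans (hy 0)
  have h1 : ∀ s, ‖Real.exp (2 * K * |s|) • A s (y s)‖ ≤ K * d * Real.exp (2 * K * |s|) := by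
    intro s
    rw [norm_smul, Real.norm_of_nonneg (Real.exp_pos _).le, mul_comm]
    gcongr
    exact ((A s).le_opNorm _).trans (mul_le_mul (hA s) (hy s) (norm_nonneg _) hK.le)
  have hc : Continuous fun s : ℝ => K * d * Real.exp (2 * K * |s|) := by fun_prop
  refine (intervalIntegral.norm_integral_le_abs_of_norm_le (Eventually.of_forall fun s => h1 s)
    (hc.intervalIntegrable 0 t)).trans ?_
  rw [intervalIntegral.integral_const_mul, abs_mul, abs_of_nonneg (by positivity)]
  calc K * d * |∫ s in (0 : ℝ)..t, Real.exp (2 * K * |s|)|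
      ≤ K * d * (Real.exp (2 * K * |t|) / (2 * K)) := by
        gcongr
        exact integral_exp_abs_le (by positivity) t
    _ = _ := by field_simp

/-- Picard iteration in the Bielecki norm: the unknown is `y = x / m` with weight `m t = exp
(2K|t|)`. The integral operator contracts bounded continuous functions on the whole line, so no
gluing of local solutions is needed. -/
theorem exists_linear_ode_solution_zero [CompleteSpace E] {A : ℝ → E →L[ℝ] E} (hAc : Continuous A)
    {K : ℝ} (hK : 0 < K) (hA : ∀ t, ‖A t‖ ≤ K) (x₀ : E) :
    ∃ x : ℝ → E, x 0 = x₀ ∧ ∀ t, HasDerivAt x (A t (x t)) t := by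
  let m : ℝ → ℝ := fun t => Real.exp (2 * K * |t|)
  have hm : Continuous m := by fun_prop
  have hm0 : ∀ t, 0 < m t := fun t => Real.exp_pos _
  have hm1 : ∀ t, 1 ≤ m t := fun t => Real.one_le_exp (by positivity)
  have hint : ∀ y : ℝ →ᵇ E, Continuous fun s => m s • A s (y s) := fun y =>
    hm.smul (hAc.clm_apply y.continuous)
  let F : (ℝ →ᵇ E) → ℝ → E := fun y t => x₀ + ∫ s in (0 : ℝ)..t, m s • A s (y s)
  have hF : ∀ y t, HasDerivAt (F y) (m t • A t (y t)) t := fun y t =>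
    ((hint y).integral_hasStrictDerivAt 0 t).hasDerivAt.const_add x₀
  have hFb : ∀ y t, ‖(m t)⁻¹ • F y t‖ ≤ ‖x₀‖ + ‖y‖ / 2 := by
    intro y t
    rw [norm_smul, norm_inv, Real.norm_of_nonneg (hm0 t).le, inv_mul_le_iff₀ (hm0 t)]
    have h1 := norm_integral_weighted_le hK hA (y := y) (fun s => y.norm_coe_le_norm s) t
    calc ‖F y t‖ ≤ ‖x₀‖ + ‖y‖ / 2 * m t := (norm_add_le _ _).trans (by gcongr)
      _ ≤ m t * ‖x₀‖ + ‖y‖ / 2 * m t := by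
        gcongr
        exact le_mul_of_one_le_left (norm_nonneg _) (hm1 t)
      _ = _ := by ring
  let Φ : (ℝ →ᵇ E) → (ℝ →ᵇ E) := fun y => BoundedContinuousFunction.ofNormedAddCommGroup
    (fun t => (m t)⁻¹ • F y t)
    ((hm.inv₀ fun t => (hm0 t).ne').smul
      (continuous_iff_continuousAt.2 fun t => (hF y t).continuousAt)) _ (hFb y)
  have hΦ : ContractingWith (1 / 2) Φ := by
    refine ⟨by norm_num, LipschitzWith.of_dist_le_mul fun y z => ?_⟩
    refine (dist_le (by positivity)).2 fun t => ?_
    have e : Φ y t - Φ z t = (m t)⁻¹ • ∫ s in (0 : ℝ)..t, m s • A s ((y - z) s) := by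
      change (m t)⁻¹ • F y t - (m t)⁻¹ • F z t = _
      rw [← smul_sub, add_sub_add_left_eq_sub, ← intervalIntegral.integral_sub
        ((hint y).intervalIntegrable _ _) ((hint z).intervalIntegrable _ _)]
      simp only [← smul_sub, ← map_sub, BoundedContinuousFunction.sub_apply]
    rw [dist_eq_norm, e, norm_smul, norm_inv, Real.norm_of_nonneg (hm0 t).le,
      inv_mul_le_iff₀ (hm0 t), dist_eq_norm]
    refine (norm_integral_weighted_le hK hA (y := ⇑(y - z))
      (fun s => (y - z).norm_coe_le_norm s) t).trans_eq ?_
    simp [m]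
    ring
  obtain ⟨y, hy⟩ : ∃ y, Φ y = y := ⟨_, hΦ.fixedPoint_isFixedPt⟩
  have hyF : ∀ t, F y t = m t • y t := fun t => by
    have : (m t)⁻¹ • F y t = y t := DFunLike.congr_fun hy t
    rw [← this, smul_inv_smul₀ (hm0 t).ne']
  refine ⟨F y, by simp [F], fun t => ?_⟩
  rw [hyF, map_smul]
  exact hF y t

theorem exists_linear_ode_solution [CompleteSpace E] {A : ℝ → E →L[ℝ] E} (hAc : Continuous A)
    {K : ℝ} (hA : ∀ t, ‖A t‖ ≤ K) (T : ℝ) (x₀ : E) :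
    ∃ x : ℝ → E, x T = x₀ ∧ ∀ t, HasDerivAt x (A t (x t)) t := by
  obtain ⟨x, hx, hd⟩ := exists_linear_ode_solution_zero (A := fun t => A (t + T))
    (hAc.comp (continuous_add_const T)) (K := max K 1) (by positivity)
    (fun t => (hA _).trans (le_max_left _ _)) x₀
  refine ⟨fun t => x (t - T), by simpa using hx, fun t => ?_⟩
  simpa using (hd (t - T)).comp_sub_const t T

end LinearODE

/-! ### Existence and uniqueness of damped solutions -/

section ExistUnique

variable {E : Type*} [NormedAddCommGroup E] [NormedSpace ℝ E]

/-- The first-order vector field of `x'' + c x' + A x = 0`. -/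
noncomputable def dampedField (A : E →L[ℝ] E) (c : ℝ) : E × E →L[ℝ] E × E :=
  ((ContinuousLinearMap.snd ℝ E E).prod (-(A.comp (ContinuousLinearMap.fst ℝ E E)))) +
    c • (0 : E × E →L[ℝ] E).prod (-ContinuousLinearMap.snd ℝ E E)

theorem dampedField_apply (A : E →L[ℝ] E) (c : ℝ) (p : E × E) :
    dampedField A c p = (p.2, -(c • p.2) - A p.1) := by
  ext <;> simp [dampedField]
  abel

theorem exists_norm_dampedField_le (A : E →L[ℝ] E) (c₀ : ℝ) :
    ∃ K, ∀ c, |c| ≤ c₀ → ‖dampedField A c‖ ≤ K :=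
  ⟨_, fun c hc => (norm_add_le _ _).trans (add_le_add le_rfl
    ((norm_smul c _).trans_le (mul_le_mul_of_nonneg_right hc (norm_nonneg _))))⟩

theorem abs_three_div_le {t₀ t : ℝ} (ht₀ : 0 < t₀) (ht : t₀ ≤ t) : |3 / t| ≤ 3 / t₀ := by
  rw [abs_of_pos (div_pos three_pos (ht₀.trans_le ht))]
  gcongr

theorem exists_isDampedSolution [CompleteSpace E] (A : E →L[ℝ] E) {t₀ : ℝ} (ht₀ : 0 < t₀)
    {T : ℝ} (x₀ v₀ : E) :
    ∃ x v, IsDampedSolution A t₀ x v ∧ x T = x₀ ∧ v T = v₀ := by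
  obtain ⟨K, hK⟩ := exists_norm_dampedField_le A (3 / t₀)
  -- Freezing the coefficient `3/t` before `t₀` makes the field continuous and bounded on all of
  -- `ℝ`, without changing it on `[t₀, ∞)`.
  have hm : ∀ t, t₀ ≤ max t t₀ := fun t => le_max_right _ _
  have hc : Continuous fun t => dampedField A (3 / max t t₀) := by
    have h3 : Continuous fun t => 3 / max t t₀ :=
      continuous_const.div (by fun_prop) fun t => (ht₀.trans_le (hm t)).ne'
    unfold dampedField
    fun_prop
  obtain ⟨p, hp, hd⟩ := exists_linear_ode_solution hc
    (fun t => hK _ (abs_three_div_le ht₀ (hm t))) T (x₀, v₀)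
  refine ⟨fun t => (p t).1, fun t => (p t).2, ⟨fun t ht => ?_, fun t ht => ?_⟩,
    by simp [hp], by simp [hp]⟩
  · have := (ContinuousLinearMap.fst ℝ E E).hasFDerivAt.comp_hasDerivAt t (hd t)
    rw [dampedField_apply] at this
    exact this.hasDerivWithinAt
  · have := (ContinuousLinearMap.snd ℝ E E).hasFDerivAt.comp_hasDerivAt t (hd t)
    rw [dampedField_apply, max_eq_left ht] at this
    exact this.hasDerivWithinAt

theorem IsDampedSolution.unique {A : E →L[ℝ] E} {t₀ : ℝ} (ht₀ : 0 < t₀) {x v x' v' : ℝ → E}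
    (h : IsDampedSolution A t₀ x v) (h' : IsDampedSolution A t₀ x' v') (hx : x t₀ = x' t₀)
    (hv : v t₀ = v' t₀) {t : ℝ} (ht : t₀ ≤ t) : x t = x' t := by
  obtain ⟨K, hK⟩ := exists_norm_dampedField_le A (3 / t₀)
  have hp : ∀ {y w : ℝ → E}, IsDampedSolution A t₀ y w → ∀ s, t₀ ≤ s →
      HasDerivWithinAt (fun s => (y s, w s)) (dampedField A (3 / s) (y s, w s)) (Set.Ici t₀) s := by
    intro y w hyw s hs
    rw [dampedField_apply]
    exact (hyw.1 s hs).prodMk (hyw.2 s hs)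
  have := ODE_solution_unique_of_mem_Icc_right (v := fun s => dampedField A (3 / s))
    (s := fun _ => Set.univ) (K := K.toNNReal) (f := fun s => (x s, v s))
    (g := fun s => (x' s, v' s)) (a := t₀) (b := t)
    (fun s hs => ((ContinuousLinearMap.lipschitz _).weaken
      (by
        rw [← NNReal.coe_le_coe, coe_nnnorm]
        exact (hK _ (abs_three_div_le ht₀ hs.1)).trans (Real.le_coe_toNNReal K))).lipschitzOnWith)
    (fun s hs => ((hp h s hs.1).mono Set.Icc_subset_Ici_self).continuousWithinAt)
    (fun s hs => (hp h s hs.1).mono (Set.Ici_subset_Ici.2 hs.1))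
    (fun _ _ => Set.mem_univ _)
    (fun s hs => ((hp h' s hs.1).mono Set.Icc_subset_Ici_self).continuousWithinAt)
    (fun s hs => (hp h' s hs.1).mono (Set.Ici_subset_Ici.2 hs.1))
    (fun _ _ => Set.mem_univ _) (by simp [hx, hv])
  exact congrArg Prod.fst (this ⟨ht, le_rfl⟩)

end ExistUnique

/-! ### Exponential growth -/

section Growth

variable {𝕜 : Type*} [RCLike 𝕜]

theorem real_inner_self_mul (μ a : 𝕜) : inner ℝ a (μ * a) = RCLike.re μ * ‖a‖ ^ 2 := by
  rw [real_inner_eq_re_inner 𝕜, RCLike.inner_apply, mul_assoc, RCLike.mul_conj,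
    ← RCLike.ofReal_pow, RCLike.re_mul_ofReal]

/-- With `A = ‖a‖²`, `B = ‖b‖²` and `c = ⟪a, b⟫`, the right side is the derivative of `A - 4B`. In
the worst case `c = -(A + B)/2` the damping costs `15/(2t) A`, which `ρ ≥ 8/t` absorbs. -/
theorem cone_deriv_le {ρ t A B c : ℝ} (ht : 0 < t) (hρt : 8 ≤ ρ * t) (hA : 0 ≤ A)
    (hB : 0 ≤ B) (hc : |c| ≤ (A + B) / 2) :
    ρ * (A - 4 * B) ≤ 2 * (ρ * A - 3 / (2 * t) * (A + c)) -
      8 * (-(ρ * B) - 3 / (2 * t) * (c + B)) := by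
  have h1 : 8 / t ≤ ρ := (div_le_iff₀ ht).2 hρt
  obtain ⟨hc1, hc2⟩ := abs_le.1 hc
  have e : 3 / (2 * t) = 3 / 16 * (8 / t) := by field_simp; norm_num
  rw [e]
  have hs : 0 < 8 / t := by positivity
  set s := 8 / t
  nlinarith [mul_nonneg hs.le hA, mul_nonneg hs.le hB, mul_le_mul_of_nonneg_left hc1 hs.le,
    mul_nonneg (sub_nonneg.2 h1) hA, mul_nonneg (sub_nonneg.2 h1) hB]

theorem IsDampedSolution.growth {lam μ : 𝕜} (hμ : μ * μ = -lam) (hre : 0 < RCLike.re μ)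
    {T : ℝ} (hT : 0 < T) (hT8 : 8 ≤ RCLike.re μ * T) {z w : ℝ → 𝕜}
    (h : IsDampedSolution (fun a => lam * a) T z w) (hz : z T = 1) (hw : w T = μ) {t : ℝ}
    (ht : T ≤ t) :
    Real.exp (-(RCLike.re μ / 2 * T)) / 2 * Real.exp (RCLike.re μ / 2 * t) ≤ ‖z t‖ := by
  set ρ := RCLike.re μ with hρ
  have hμ0 : μ ≠ 0 := fun h0 => by simp [hρ, h0] at hre
  let a : ℝ → 𝕜 := fun s => w s + μ * z s
  let b : ℝ → 𝕜 := fun s => w s - μ * z s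
  have hab : ∀ s, a s + b s = (2 : ℝ) • w s := fun s => by
    simp only [a, b, two_smul]
    ring
  have hda : ∀ s ∈ Set.Ici T,
      HasDerivWithinAt a (μ * a s - (3 / (2 * s)) • (a s + b s)) (Set.Ici T) s := fun s hs => by
    refine ((h.2 s hs).add ((h.1 s hs).const_mul μ)).congr_deriv ?_
    have hs0 : s ≠ 0 := (hT.trans_le hs).ne'
    have e : 3 / (2 * s) * 2 = 3 / s := by field_simp
    rw [hab, smul_smul, e]
    simp only [a, mul_add, ← mul_assoc, hμ]
    ring
  have hdb : ∀ s ∈ Set.Ici T,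
      HasDerivWithinAt b (-μ * b s - (3 / (2 * s)) • (a s + b s)) (Set.Ici T) s := fun s hs => by
    refine ((h.2 s hs).sub ((h.1 s hs).const_mul μ)).congr_deriv ?_
    have hs0 : s ≠ 0 := (hT.trans_le hs).ne'
    have e : 3 / (2 * s) * 2 = 3 / s := by field_simp
    rw [hab, smul_smul, e]
    simp only [b, neg_mul, mul_sub, ← mul_assoc, hμ]
    ring
  have hmono : -(Real.exp (-(ρ * t)) * (‖a t‖ ^ 2 - 4 * ‖b t‖ ^ 2)) ≤
      -(Real.exp (-(ρ * T)) * (‖a T‖ ^ 2 - 4 * ‖b T‖ ^ 2)) := by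
    refine antitoneOn_Ici_of_deriv
      (f := fun s => -(Real.exp (-(ρ * s)) * (‖a s‖ ^ 2 - 4 * ‖b s‖ ^ 2)))
      (f' := fun s => Real.exp (-(ρ * s)) * (ρ * (‖a s‖ ^ 2 - 4 * ‖b s‖ ^ 2) -
        (2 * (ρ * ‖a s‖ ^ 2 - 3 / (2 * s) * (‖a s‖ ^ 2 + inner ℝ (a s) (b s))) -
        8 * (-(ρ * ‖b s‖ ^ 2) - 3 / (2 * s) * (inner ℝ (a s) (b s) + ‖b s‖ ^ 2)))))
      (fun s hs => ?_) (fun s hs => ?_) Set.self_mem_Ici (Set.mem_Ici.2 ht) ht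
    · have he := (((hasDerivWithinAt_id s (Set.Ici T)).const_mul ρ).neg).exp
      refine (he.mul ((hda s hs).norm_sq.sub ((hdb s hs).norm_sq.const_mul 4))).neg.congr_deriv ?_
      simp only [inner_sub_right, inner_smul_right, inner_add_right, real_inner_self_mul,
        real_inner_self_eq_norm_sq, map_neg, real_inner_comm (a s) (b s), id, ← hρ]
      simp
      ring
    · have hs0 : 0 < s := hT.trans_le hs
      refine mul_nonpos_of_nonneg_of_nonpos (Real.exp_pos _).le (sub_nonpos.2 ?_)
      refine cone_deriv_le hs0 (hT8.trans (mul_le_mul_of_nonneg_left hs hre.le))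
        (sq_nonneg _) (sq_nonneg _) ((abs_real_inner_le_norm _ _).trans ?_)
      nlinarith [sq_nonneg (‖a s‖ - ‖b s‖)]
  have haT : ‖a T‖ = 2 * ‖μ‖ := by
    have : a T = 2 * μ := by simp only [a, hz, hw]; ring
    rw [this, norm_mul, RCLike.norm_ofNat]
  have hbT : b T = 0 := by simp [b, hz, hw]
  rw [haT, hbT, norm_zero] at hmono
  set g := Real.exp (-(ρ / 2 * T)) * Real.exp (ρ / 2 * t) with hg
  have hg0 : 0 < g := by positivity
  have hgsq : g ^ 2 = Real.exp (-(ρ * T)) * (Real.exp (-(ρ * t)))⁻¹ := by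
    rw [hg, ← Real.exp_add, ← Real.exp_nat_mul, ← Real.exp_neg, ← Real.exp_add]
    congr 1
    push_cast
    ring
  have hD : (2 * ‖μ‖ * g) ^ 2 ≤ ‖a t‖ ^ 2 - 4 * ‖b t‖ ^ 2 := by
    rw [mul_pow, hgsq, ← div_eq_mul_inv, mul_div_assoc', div_le_iff₀ (Real.exp_pos _)]
    linarith
  -- The weight 4 gives `‖b‖ ≤ ‖a‖/2`, so `2 μ z = a - b` has norm at least `‖a‖/2`.
  have h1 : 2 * ‖μ‖ * g ≤ ‖a t‖ :=
    le_of_sq_le_sq (by nlinarith [sq_nonneg ‖b t‖]) (norm_nonneg _)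
  have h2 : 2 * ‖b t‖ ≤ ‖a t‖ :=
    le_of_sq_le_sq (by nlinarith [sq_nonneg (2 * ‖μ‖ * g)]) (norm_nonneg _)
  have h3 : ‖a t‖ - ‖b t‖ ≤ 2 * (‖μ‖ * ‖z t‖) := by
    have : a t - b t = 2 * (μ * z t) := by simp only [a, b]; ring
    refine (norm_sub_norm_le _ _).trans_eq ?_
    rw [this, norm_mul, norm_mul, RCLike.norm_ofNat]
  have h4 : ‖μ‖ * (g / 2) ≤ ‖μ‖ * ‖z t‖ := by linarith
  have := le_of_mul_le_mul_left h4 (norm_pos_iff.2 hμ0)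
  rw [div_mul_eq_mul_div]
  exact this

theorem exists_growing_solution {lam μ : 𝕜} (hμ : μ * μ = -lam) (hre : 0 < RCLike.re μ) {t₀ : ℝ}
    (ht₀ : 0 < t₀) :
    ∃ z w : ℝ → 𝕜, IsDampedSolution (fun a => lam * a) t₀ z w ∧
      ∃ c > (0 : ℝ), ∃ α > (0 : ℝ), ∀ᶠ t in atTop, c * Real.exp (α * t) ≤ ‖z t‖ := by
  set T := max t₀ (8 / RCLike.re μ)
  have hT : 0 < T := lt_max_of_lt_left ht₀
  have hT8 : 8 ≤ RCLike.re μ * T := by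
    rw [mul_comm, ← div_le_iff₀ hre]
    exact le_max_right _ _
  obtain ⟨z, w, h, hz, hw⟩ := exists_isDampedSolution
    (ContinuousLinearMap.mul ℝ 𝕜 lam) ht₀ (T := T) 1 μ
  have h : IsDampedSolution (fun a => lam * a) t₀ z w := h
  refine ⟨z, w, h, Real.exp (-(RCLike.re μ / 2 * T)) / 2, half_pos (Real.exp_pos _),
    RCLike.re μ / 2, half_pos hre, ?_⟩
  filter_upwards [eventually_ge_atTop T] with t ht
  exact (h.mono (le_max_left _ _)).growth hμ hre hT hT8 hz hw ht

/-! ### From scalar growth to growing trajectories and instability. -/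

variable {N : ℕ} {G : Matrix (Fin N) (Fin N) ℝ} {t₀ : ℝ}

theorem exists_growing_trajectory {lam μ : 𝕜} (hμ : μ * μ = -lam) (hre : 0 < RCLike.re μ)
    (ht₀ : 0 < t₀) (L : 𝕜 →ₗ[ℝ] EuclideanSpace ℝ (Fin N)) (hL : LinearMap.ker L = ⊥)
    (hG : ∀ a, L (lam * a) = WithLp.toLp 2 (G.mulVec (L a))) :
    ∃ q v, IsTrajectory G t₀ q v ∧ GrowsExponentially q := by
  obtain ⟨z, w, h, c, hc, α, hα, hz⟩ := exists_growing_solution hμ hre ht₀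
  obtain ⟨K, hK, hKL⟩ := L.exists_antilipschitzWith hL
  have hK : (0 : ℝ) < K := hK
  refine ⟨_, _, isTrajectory_iff.2 (h.comp (LinearMap.toContinuousLinearMap L) hG),
    c / K, div_pos hc hK, α, hα, ?_⟩
  filter_upwards [hz] with t ht
  have h1 : ‖z t‖ ≤ K * ‖L (z t)‖ := by simpa using hKL.le_mul_dist (z t) 0
  rw [div_mul_eq_mul_div, div_le_iff₀ hK, mul_comm _ (K : ℝ)]
  exact ht.trans h1

theorem exists_sqrt_neg {lam : ℂ} (h : lam ∉ nonnegReals) : ∃ μ : ℂ, μ * μ = -lam ∧ 0 < μ.re := by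
  obtain ⟨μ, hμ⟩ := IsAlgClosed.exists_pow_nat_eq (-lam) two_pos
  rw [sq] at hμ
  rcases lt_trichotomy μ.re 0 with h0 | h0 | h0
  · exact ⟨-μ, by rw [neg_mul_neg, hμ], by simpa using h0⟩
  -- A purely imaginary `μ` would give `lam = (im μ)² ≥ 0`.
  · refine absurd (show lam ∈ nonnegReals from ⟨μ.im * μ.im, Set.mem_Ici.2 (mul_self_nonneg μ.im), ?_⟩) h
    rw [← neg_eq_iff_eq_neg.2 hμ]
    apply Complex.ext <;> simp [h0]
  · exact ⟨μ, hμ, h0⟩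

theorem exists_isTrajectory_growsExponentially (ht₀ : 0 < t₀) {lam : ℂ} (hlam : IsEigenvalue G lam)
    (h : lam ∉ nonnegReals) : ∃ q v, IsTrajectory G t₀ q v ∧ GrowsExponentially q := by
  obtain ⟨μ, hμ, hre⟩ := exists_sqrt_neg h
  obtain ⟨x, hx, hx0⟩ := Module.End.HasEigenvalue.exists_hasEigenvector hlam
  have hx : ∀ i, ∑ j, (G i j : ℂ) * x j = lam * x i := fun i => by
    simpa [Matrix.mulVec, dotProduct] using
      congrFun (Module.End.mem_eigenspace_iff.1 hx) i
  -- Since `G` is real, taking real parts of `G (a x) = lam a x` shows that `L` intertwines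
  -- multiplication by `lam` with `G`.
  let L : ℂ →ₗ[ℝ] EuclideanSpace ℝ (Fin N) :=
    { toFun := fun a => WithLp.toLp 2 fun i => (a * x i).re
      map_add' := fun a b => by ext i; simp [add_mul]
      map_smul' := fun c a => by ext i; simp [mul_assoc] }
  have hLi : ∀ a i, L a i = (a * x i).re := fun a i => rfl
  have hL : ∀ a, L (lam * a) = WithLp.toLp 2 (G.mulVec (L a)) := fun a => by
    ext i
    simp only [Matrix.mulVec, dotProduct, hLi]
    rw [mul_right_comm, ← hx i, mul_comm, Finset.mul_sum, Complex.re_sum]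
    refine Finset.sum_congr rfl fun j _ => ?_
    rw [mul_left_comm, Complex.re_ofReal_mul]
  by_cases hker : LinearMap.ker L = ⊥
  · exact exists_growing_trajectory hμ hre ht₀ L hker hL
  -- If `L` is not injective, some `a x` is purely imaginary. This forces `lam` to be real, hence
  -- negative, and `L (I a)` is a real eigenvector, so the scalar argument is run over `ℝ`.
  obtain ⟨a, ha, ha0⟩ := (Submodule.ne_bot_iff _).1 hker
  have haL : L a = 0 := ha
  have hIa : L (Complex.I * a) ≠ 0 := fun h0 => by
    refine hx0 (funext fun i => ?_)
    have h1 : (a * x i).re = 0 := by rw [← hLi, haL]; rfl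
    have h2 : (Complex.I * (a * x i)).re = 0 := by rw [← mul_assoc, ← hLi, h0]; rfl
    have h3 : a * x i = 0 := Complex.ext h1 (neg_eq_zero.1 ((Complex.I_mul_re _).symm.trans h2))
    exact (mul_eq_zero.1 h3).resolve_left ha0
  have him : lam.im = 0 := by
    have h1 : L (lam * a) = 0 := by rw [hL, haL]; ext i; simp
    have h2 : lam * a = (lam.re : ℝ) • a + lam.im • (Complex.I * a) := by
      rw [Complex.real_smul, Complex.real_smul]
      nth_rewrite 1 [← Complex.re_add_im lam]
      ring
    rw [h2, map_add, map_smul, map_smul, haL, smul_zero, zero_add] at h1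
    exact (smul_eq_zero.1 h1).resolve_right hIa
  have hneg : lam.re < 0 := by
    by_contra! h0
    exact h ⟨lam.re, h0, Complex.ext rfl (by simp [him])⟩
  have hlam : lam = (lam.re : ℂ) := Complex.ext rfl (by simp [him])
  refine exists_growing_trajectory (𝕜 := ℝ) (lam := lam.re) (μ := √(-lam.re))
    (Real.mul_self_sqrt (by linarith)) (by simpa using hneg) ht₀
    (LinearMap.toSpanSingleton ℝ _ (L (Complex.I * a))) ?_ fun r => ?_
  · exact LinearMap.ker_toSpanSingleton ℝ hIa
  · simp only [LinearMap.toSpanSingleton_apply]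
    rw [← map_smul, ← map_smul, ← hL, mul_smul, Complex.real_smul (x := lam.re), ← hlam]

theorem GrowsExponentially.tendsto_norm {q : ℝ → EuclideanSpace ℝ (Fin N)}
    (h : GrowsExponentially q) : Tendsto (fun t => ‖q t‖) atTop atTop := by
  obtain ⟨c, hc, α, hα, h⟩ := h
  exact tendsto_atTop_mono' _ h
    ((Real.tendsto_exp_atTop.comp (tendsto_id.const_mul_atTop hα)).const_mul_atTop hc)

theorem IsTrajectory.unique (ht₀ : 0 < t₀) {q v q' v' : ℝ → EuclideanSpace ℝ (Fin N)}
    (h : IsTrajectory G t₀ q v) (h' : IsTrajectory G t₀ q' v') (hq : q t₀ = q' t₀)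
    (hv : v t₀ = v' t₀) {t : ℝ} (ht : t₀ ≤ t) : q t = q' t := by
  have e : (fun x : EuclideanSpace ℝ (Fin N) =>
      (WithLp.toLp 2 (G.mulVec x) : EuclideanSpace ℝ (Fin N))) =
      Matrix.toEuclideanCLM (n := Fin N) (𝕜 := ℝ) G := by
    ext x i
    simp [Matrix.ofLp_toEuclideanCLM]
  rw [isTrajectory_iff, e] at h h'
  exact h.unique ht₀ h' hq hv ht

theorem IsTrajectory.smul {q v : ℝ → EuclideanSpace ℝ (Fin N)} (h : IsTrajectory G t₀ q v)
    (s : ℝ) : IsTrajectory G t₀ (fun t => s • q t) (fun t => s • v t) := by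
  refine isTrajectory_iff.2 ((isTrajectory_iff.1 h).comp
    (s • ContinuousLinearMap.id ℝ (EuclideanSpace ℝ (Fin N))) fun a => ?_)
  ext i
  simp [Matrix.mulVec_smul]

theorem not_isStable {q v : ℝ → EuclideanSpace ℝ (Fin N)} (h : IsTrajectory G t₀ q v)
    (hq : GrowsExponentially q) : ¬ IsStable G t₀ := by
  intro hs
  obtain ⟨δ, hδ, H⟩ := hs 1 one_pos
  -- The summand 1 keeps `m` positive and makes the scaled initial data strictly smaller than `δ`.
  set m := ‖q t₀‖ + ‖v t₀‖ + 1
  have hm : 0 < m := by positivity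
  have hs0 : 0 < δ / m := div_pos hδ hm
  have hsmall : ‖(δ / m) • q t₀‖ + ‖(δ / m) • v t₀‖ < δ := by
    rw [norm_smul, norm_smul, Real.norm_of_nonneg hs0.le, ← mul_add, div_mul_eq_mul_div,
      div_lt_iff₀ hm]
    exact mul_lt_mul_of_pos_left (lt_add_one _) hδ
  obtain ⟨t, ht, ht0⟩ := ((hq.tendsto_norm.eventually_ge_atTop (δ / m)⁻¹).and
    (eventually_ge_atTop t₀)).exists
  have h1 := H _ _ (h.smul (δ / m)) hsmall t ht0
  have h2 : 1 ≤ ‖(δ / m) • q t‖ := by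
    rw [norm_smul, Real.norm_of_nonneg hs0.le, ← inv_mul_le_iff₀ hs0, mul_one]
    exact ht
  linarith [norm_nonneg ((δ / m) • v t)]

end Growth

end NAGD

theorem mainTheorem1 (N : ℕ) (G : Matrix (Fin N) (Fin N) ℝ) (t₀ : ℝ) (ht₀ : 0 < t₀) :
    ((∃ lam : ℂ, NAGD.IsEigenvalue G lam ∧ lam ∉ NAGD.nonnegReals) →
      (∃ q₀ v₀ : EuclideanSpace ℝ (Fin N),
        (∃ q v : ℝ → EuclideanSpace ℝ (Fin N),
          NAGD.IsTrajectory G t₀ q v ∧ q t₀ = q₀ ∧ v t₀ = v₀) ∧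
        ∀ q v : ℝ → EuclideanSpace ℝ (Fin N),
          NAGD.IsTrajectory G t₀ q v → q t₀ = q₀ → v t₀ = v₀ → NAGD.GrowsExponentially q) ∧
      ¬ NAGD.IsStable G t₀) ∧
    ((∀ lam : ℂ, NAGD.IsEigenvalue G lam → lam ∈ NAGD.nonnegReals) →
      NAGD.IsDiagonalizable G →
      ∀ q v : ℝ → EuclideanSpace ℝ (Fin N), NAGD.IsTrajectory G t₀ q v →
        (∃ M : ℝ, ∀ t ≥ t₀, ‖q t‖ ≤ M ∧ ‖v t‖ ≤ M) ∧
        (∃ qlim : EuclideanSpace ℝ (Fin N), Tendsto q atTop (𝓝 qlim)) ∧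
        Tendsto v atTop (𝓝 0) ∧
        ∀ (𝕜 : Type) [RCLike 𝕜] (P : Matrix (Fin N) (Fin N) 𝕜), NAGD.Diagonalizes P G →
          ∀ t ≥ t₀, ‖q t‖ ≤
            NAGD.condNumber P * (‖q t₀‖ + NAGD.growthConst G t₀ * ‖v t₀‖)) := by
  refine ⟨?_, ?_⟩
  · rintro ⟨lam, hlam, h⟩
    obtain ⟨q, v, hqv, hq⟩ := NAGD.exists_isTrajectory_growsExponentially ht₀ hlam h
    refine ⟨⟨q t₀, v t₀, ⟨q, v, hqv, rfl, rfl⟩, fun q' v' h' hq' hv' => ?_⟩,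
      NAGD.not_isStable hqv hq⟩
    obtain ⟨c, hc, α, hα, hg⟩ := hq
    refine ⟨c, hc, α, hα, ?_⟩
    filter_upwards [hg, eventually_ge_atTop t₀] with t ht ht0
    rwa [h'.unique ht₀ hqv hq' hv' ht0]
  · rintro hG ⟨P, hP⟩ q v h
    obtain ⟨hq, hv⟩ := h.exists_tendsto ht₀ hP hG
    exact ⟨h.exists_bound ht₀ hP hG, hq, hv, fun 𝕜 _ P' hP' t ht =>
      h.norm_position_le ht₀ hP' hG ht⟩
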